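/- Let $(R,\mathfrak m)$ be a one-dimensional Cohen–Macaulay (Noetherian) local ring with infinite residue field, and assume that $R$ is analytically unramified, i.e. that its $\mathfrak m$-adic completion is reduced. Let $\nu$ be the embedding dimension of $R$ (the minimal number of generators of $\mathfrak m$), let $e(R)=\lim_{n\to\infty}\ell(R/\mathfrak m^n)/n$ be its multiplicity, where $\ell$ denotes length of $R$-modules, let $\overline R$ be the integral closure of $R$ in its total ring of fractions, and let $\mathfrak c = R:\overline R=\{r\in R : r\overline R\subseteq R\}$ be the conductor. Then the limit defining $e(R)$ exists, $\ell(R/\mathfrak c)$ is finite, and $$e(R)\le(\nu-1)\,\ell(R/\mathfrak c)+1.$$ Moreover, equality holds if and only if $R$ is a discrete valuation ring or $\ell(R/\mathfrak c)=1$; and $\ell(R/\mathfrak c)=1$ if and only if $\mathfrak m=\mathfrak c$. -/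

import Mathlib

open Filter Topology

namespace LocalRingInvariants

open IsLocalRing

section Invariants

variable (R : Type*) [CommRing R]

/-- The integral closure of `R` in its total ring of fractions `Q(R)`, the localization of `R` at
the set of all its non-zero-divisors. -/
noncomputable abbrev normalization : Subalgebra R (FractionRing R) :=
  integralClosure R (FractionRing R)

/-- The conductor `R : R̄`, where `R̄` is the integral closure of `R` in its total ring of fractions.
It is the set of all `r` such that `r • b` lies in (the image of) `R` for every `b` in `R̄`; as
`1 ∈ R̄`, every element of `Q(R)` that multiplies `R̄` into `R` comes from such an `r`, so the
conductor is an ideal of `R`. The submodule `1` of `Q(R)` is the image of `R`. -/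
noncomputable def conductorIdeal : Ideal R :=
  (1 : Submodule R (FractionRing R)).colon (normalization R : Set (FractionRing R))

variable [IsLocalRing R]

/-- The embedding dimension of a local ring: the minimal number of generators of its
maximal ideal. -/
noncomputable def embeddingDim : ℕ := (maximalIdeal R).spanFinrank

/-- A local ring is Cohen–Macaulay if it is Noetherian and its maximal ideal contains a regular
sequence whose length is the Krull dimension of the ring. -/
structure IsCohenMacaulay : Prop where
  isNoetherianRing : IsNoetherianRing R
  exists_isRegular : ∃ rs : List R, (∀ r ∈ rs, r ∈ maximalIdeal R) ∧
    RingTheory.Sequence.IsRegular R rs ∧ (rs.length : WithBot ℕ∞) = ringKrullDim R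

/-- A local ring is analytically unramified if its completion with respect to the maximal ideal is
a reduced ring. -/
def IsAnalyticallyUnramified : Prop := IsReduced (AdicCompletion (maximalIdeal R) R)

/-- The Krull dimension of a Noetherian local ring (which is finite), as a natural number. -/
noncomputable def dim : ℕ := ((ringKrullDim R).unbotD 0).toNat

/-- The normalized Hilbert–Samuel function `n ↦ d! · ℓ(R / 𝔪ⁿ) / n ^ d`, where `d = dim R`. -/
noncomputable def normalizedHilbertSamuel (n : ℕ) : ℝ :=
  ((dim R).factorial : ℝ) * ((Module.length R (R ⧸ maximalIdeal R ^ n)).toNat : ℝ) / (n : ℝ) ^ dim R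

/-- The (Hilbert–Samuel) multiplicity `e(R)` of a Noetherian local ring, the limit of
`d! · ℓ(R / 𝔪ⁿ) / n ^ d` as `n` tends to infinity, where `d = dim R`. -/
noncomputable def hilbertSamuelMultiplicity : ℝ := limUnder atTop (normalizedHilbertSamuel R)

end Invariants

end LocalRingInvariants

/-!
Write `𝔪` for the maximal ideal, `ν` for the embedding dimension, `R̄` for the normalization and
`𝔠` for the conductor. Since the residue field is infinite, `𝔪` has a minimal reduction: a
non-zero-divisor `x ∈ 𝔪` with `𝔪 ^ (n + 1) = x 𝔪 ^ n` for some `n` (`exists_minimalReduction`).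
Then `e(R) = ℓ(R / x R)` (`tendsto_normalizedHilbertSamuel`), and `𝔪 ⊆ x R̄` because
multiplication by `y / x` with `y ∈ 𝔪` preserves `𝔪 ^ n` (`exists_isIntegral_mul_eq`).

Hence `𝔠 𝔪 ⊆ x 𝔠 ⊆ x R`, so `M = 𝔪 / x R` is an `R / 𝔠`-module. As `x ∉ 𝔪 ^ 2`, it has `ν - 1`
generators (`embeddingDim_eq`), and `e(R) - 1 = ℓ(M) ≤ (ν - 1) ℓ(R / 𝔠)`. In fact `𝔠 + x R` kills
`M`, so for `ν > 1` equality forces `x ∈ 𝔠`, whence `𝔪 ⊆ x R̄ ⊆ 𝔠`, and `𝔠 ≠ R` since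
`ℓ(M) ≥ ν - 1 > 0` makes `ℓ(R / 𝔠)` positive; thus `𝔪 = 𝔠`. For `ν = 1`, equality gives
`𝔪 = x R`, so the ring is a discrete valuation ring. Conversely `ν - 1 ≤ ℓ(M)`,
which gives equality if `ℓ(R / 𝔠) = 1`.

Two ingredients take more work.

* Existence of the reduction. The powers of `𝔪` have boundedly many generators, and the theorem of
  Eakin and Sathaye for one general element (`exists_mul_pow_eq_of_finrank_le`), applied to the
  associated graded ring, yields `x`.
* Finiteness of `ℓ(R / 𝔠)`, that is, `x ^ n ∈ 𝔠` for some `n` (`exists_pow_mem_conductorIdeal`).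
  The rings `R[β]` with `β` integral have boundedly many generators, so every such `β` satisfies a
  monic equation of bounded degree; thus `b ∈ x ^ n R̄ ∩ R` implies `b ^ d ∈ x ^ n R` with `d`
  independent of `n` and `b`. If none of the ideals `x ^ n R̄ ∩ R` were contained in `x R`, a
  compactness argument would produce a non-zero nilpotent element of the completion
  (`exists_le_of_isReduced_adicCompletion`). Hence one of them is contained in `x R`, and dividing
  by `x` repeatedly gives `x ^ n R̄ ⊆ R`.
-/

namespace OneDimLocal

/-! ### Multiplication by a general linear form -/

section EakinSathaye

variable {k : Type*} [Field k] [Infinite k]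

/-- If `f` has maximal rank in the pencil `f + s • g`, then `g` maps the kernel of `f` into the
range of `f`. Otherwise, lifting a basis of the range of `f` and adding `u` yields vectors whose
images under `f + s • g` are independent for all but finitely many `s`, which raises the rank. -/
theorem apply_mem_range_of_finrank_range_add_smul_le {U W : Type*} [AddCommGroup U] [Module k U]
    [AddCommGroup W] [Module k W] [FiniteDimensional k U] (f g : U →ₗ[k] W)
    (h : ∀ s : k, Module.finrank k (LinearMap.range (f + s • g)) ≤
      Module.finrank k (LinearMap.range f)) {u : U} (hu : f u = 0) :
    g u ∈ LinearMap.range f := by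
  classical
  by_contra hgu
  let b := Module.finBasis k (LinearMap.range f)
  set r := Module.finrank k (LinearMap.range f) with hr
  choose v hv using fun i : Fin r ↦ (b i).2
  let w : k → Option (Fin r) → W := fun s i ↦ i.elim (g u) fun i ↦ f (v i) + s • g (v i)
  have hw0 : LinearIndependent k (w 0) := by
    rw [linearIndependent_option]
    have h1 : (w 0 ∘ some : Fin r → W) = fun i ↦ (b i : W) := by
      funext i; simp [w, hv]
    refine ⟨?_, ?_⟩
    · change LinearIndependent k (w 0 ∘ some)
      rw [h1]
      exact b.linearIndependent.map' (Submodule.subtype _) (Submodule.ker_subtype _)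
    · change w 0 none ∉ Submodule.span k (Set.range (w 0 ∘ some))
      rw [h1]
      intro hmem
      refine hgu ?_
      refine Submodule.span_le.2 ?_ hmem
      rintro _ ⟨i, rfl⟩
      exact (b i).2
  obtain ⟨φ, hφ⟩ := LinearMap.exists_extend hw0.repr
  have hφ0 : ∀ i, φ (w 0 i) = Finsupp.single i 1 := fun i ↦ by
    have := LinearMap.congr_fun hφ ⟨w 0 i, Submodule.subset_span ⟨i, rfl⟩⟩
    simp only [LinearMap.comp_apply, Submodule.subtype_apply] at this
    rw [this]
    exact hw0.repr_eq_single i _ rfl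
  -- `φ` sends the family `w s` to the standard basis vectors transformed by `1 + s • B`
  let B : Module.End k (Option (Fin r) →₀ k) := Finsupp.linearCombination k
    fun i : Option (Fin r) ↦ i.elim 0 fun i ↦ φ (g (v i))
  -- `1 - μ⁻¹ • B` is injective when `μ` is not an eigenvalue of `B`
  obtain ⟨μ, hμ⟩ := ((Module.End.finite_hasEigenvalue B).insert 0).exists_notMem
  rw [Set.mem_insert_iff, not_or] at hμ
  have hws : LinearIndependent k (w (-μ⁻¹)) := by
    refine LinearIndependent.of_comp φ ?_
    have h2 : φ ∘ w (-μ⁻¹) = ((1 - μ⁻¹ • B : Module.End k _) : _ → _) ∘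
        fun i ↦ (Finsupp.single i 1 : Option (Fin r) →₀ k) := by
      funext i
      cases i with
      | none =>
        have := hφ0 none
        simp [w, B] at this ⊢
        exact this
      | some i =>
        have := hφ0 (some i)
        simp [w, B] at this ⊢
        rw [this, sub_eq_add_neg]
    rw [h2]
    refine LinearIndependent.map' (Finsupp.basisSingleOne (R := k)).linearIndependent _ ?_
    refine LinearMap.ker_eq_bot'.2 fun y hy ↦ ?_
    by_contra hy0
    refine hμ.2 (Module.End.hasEigenvalue_of_hasEigenvector (x := y)
      (Module.End.hasEigenvector_iff.2 ⟨Module.End.mem_eigenspace_iff.2 ?_, hy0⟩))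
    have h3 : y = μ⁻¹ • B y := by simpa [sub_eq_zero] using hy
    conv_rhs => rw [h3]
    rw [smul_smul, mul_inv_cancel₀ hμ.1, one_smul]
  have hmem : ∀ i, w (-μ⁻¹) i ∈ LinearMap.range (f + (-μ⁻¹) • g) := by
    intro i
    cases i with
    | none => exact ⟨-μ • u, by simp [w, hu, smul_smul, hμ.1]⟩
    | some i => exact ⟨v i, by simp [w]⟩
  have hcard := (LinearIndependent.of_comp (Submodule.subtype _)
    (v := fun i ↦ (⟨w (-μ⁻¹) i, hmem i⟩ : LinearMap.range (f + (-μ⁻¹) • g))) hws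
    ).fintype_card_le_finrank
  have := h (-μ⁻¹)
  simp only [Fintype.card_option, Fintype.card_fin] at hcard
  omega

/-- The case of one general element of the theorem of Eakin and Sathaye: if `a * V ^ (n + 1)` has
dimension at most `n + 1`, then it equals `a * y * V ^ n` for some `y` in `V`. The induction on
`n` lets `a` vary: if no `x` in `V` works, `a * x * V ^ n` has smaller dimension for every `x`,
and the `y` obtained for `a * x` with `x` of maximal rank also works for `a`. -/
theorem exists_mul_pow_eq_of_finrank_le {A : Type*} [CommRing A] [Algebra k A]
    (V : Submodule k A) (hV : V.FG) (n : ℕ) (a : A)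
    (h : Module.finrank k ((V ^ (n + 1)).map (LinearMap.mulLeft k a)) ≤ n + 1) :
    ∃ y ∈ V, (V ^ (n + 1)).map (LinearMap.mulLeft k a) ≤
      (V ^ n).map (LinearMap.mulLeft k (a * y)) := by
  have hfd (j : ℕ) : FiniteDimensional k ↥(V ^ j) := Module.Finite.iff_fg.2 (hV.pow j)
  induction n generalizing a with
  | zero =>
    by_cases h0 : ∃ x ∈ V, a * x ≠ 0
    · obtain ⟨x, hx, hax⟩ := h0
      refine ⟨x, hx, ?_⟩
      have hle : (V ^ 0).map (LinearMap.mulLeft k (a * x)) ≤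
          (V ^ (0 + 1)).map (LinearMap.mulLeft k a) := by
        rintro _ ⟨v, hv, rfl⟩
        exact ⟨x * v, by rw [pow_succ']; exact Submodule.mul_mem_mul hx hv, by simp⟩
      refine (Submodule.eq_of_le_of_finrank_le hle (h.trans ?_)).ge
      rw [zero_add, Nat.one_le_iff_ne_zero, Ne, Submodule.finrank_eq_zero]
      refine (Submodule.ne_bot_iff _).2 ⟨a * x, ⟨1, ?_, by simp⟩, hax⟩
      simp [Submodule.one_le.1 le_rfl]
    · push Not at h0
      refine ⟨0, zero_mem _, ?_⟩
      rintro _ ⟨v, hv, rfl⟩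
      rw [zero_add, pow_one] at hv
      simp [h0 v hv]
  | succ n ih =>
    -- an element `x` of `V` for which multiplication by `a * x` on `V ^ (n + 1)` has maximal rank
    obtain ⟨x, hx⟩ : ∃ x : V, ∀ x' : V,
        Module.finrank k ((V ^ (n + 1)).map (LinearMap.mulLeft k (a * x'))) ≤
        Module.finrank k ((V ^ (n + 1)).map (LinearMap.mulLeft k (a * x))) := by
      let r : V → ℕ := fun x ↦ Module.finrank k ((V ^ (n + 1)).map (LinearMap.mulLeft k (a * x)))
      refine ⟨Function.argmin (fun x ↦ Module.finrank k ↥(V ^ (n + 1)) - r x), fun x' ↦ ?_⟩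
      have h1 := Function.argmin_le (fun x ↦ Module.finrank k ↥(V ^ (n + 1)) - r x) x'
      have h2 (x : V) : r x ≤ Module.finrank k ↥(V ^ (n + 1)) := Submodule.finrank_map_le _ _
      have := h2 x'
      have := h2 (Function.argmin (fun x ↦ Module.finrank k ↥(V ^ (n + 1)) - r x))
      change r x' ≤ r _
      omega
    have hle : (V ^ (n + 1)).map (LinearMap.mulLeft k (a * x)) ≤
        (V ^ (n + 1 + 1)).map (LinearMap.mulLeft k a) := by
      rintro _ ⟨v, hv, rfl⟩
      exact ⟨x * v, by rw [pow_succ']; exact Submodule.mul_mem_mul x.2 hv, by simp⟩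
    by_cases hr : Module.finrank k ((V ^ (n + 1 + 1)).map (LinearMap.mulLeft k a)) ≤
        Module.finrank k ((V ^ (n + 1)).map (LinearMap.mulLeft k (a * x)))
    · exact ⟨x, x.2, (Submodule.eq_of_le_of_finrank_le hle hr).ge⟩
    obtain ⟨y, hy, hyle⟩ := ih (a * x) (by omega)
    refine ⟨y, hy, ?_⟩
    rw [Submodule.map_le_iff_le_comap, pow_succ' V (n + 1), Submodule.mul_le]
    intro w hw v hv
    obtain ⟨v', hv', hvv'⟩ := hyle ⟨v, hv, rfl⟩
    simp only [LinearMap.mulLeft_apply] at hvv'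
    have hyv' : y * v' ∈ V ^ (n + 1) := by
      rw [pow_succ']; exact Submodule.mul_mem_mul hy hv'
    -- `v - y * v'` is killed by `a * x`, so maximality of the rank applies to it
    have key : a * w * (v - y * v') ∈ (V ^ (n + 1)).map (LinearMap.mulLeft k (a * x)) := by
      have := apply_mem_range_of_finrank_range_add_smul_le
        ((LinearMap.mulLeft k (a * x)).domRestrict (V ^ (n + 1)))
        ((LinearMap.mulLeft k (a * w)).domRestrict (V ^ (n + 1))) (fun s ↦ ?_)
        (u := ⟨v - y * v', sub_mem hv hyv'⟩) ?_
      · rwa [LinearMap.range_domRestrict] at this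
      · have hs : (LinearMap.mulLeft k (a * x)).domRestrict (V ^ (n + 1)) +
            s • (LinearMap.mulLeft k (a * w)).domRestrict (V ^ (n + 1)) =
            (LinearMap.mulLeft k (a * (x + s • ⟨w, hw⟩ : V))).domRestrict (V ^ (n + 1)) := by
          ext z; simp [mul_add, add_mul, mul_assoc]
        rw [hs, LinearMap.range_domRestrict, LinearMap.range_domRestrict]
        exact hx _
      · simp only [LinearMap.domRestrict_apply, LinearMap.mulLeft_apply]
        linear_combination -hvv'
    obtain ⟨v₂, hv₂, h₂⟩ := hyle key
    simp only [LinearMap.mulLeft_apply] at h₂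
    refine ⟨x * v₂ + w * v', add_mem ?_ ?_, ?_⟩
    · rw [pow_succ']; exact Submodule.mul_mem_mul x.2 hv₂
    · rw [pow_succ']; exact Submodule.mul_mem_mul hw hv'
    · simp only [LinearMap.mulLeft_apply]
      linear_combination h₂

end EakinSathaye

/-! ### Lengths and numbers of generators -/

section Length

variable {R : Type*} [CommRing R]

theorem length_quotient_map {M N : Type*} [AddCommGroup M] [Module R M] [AddCommGroup N]
    [Module R N] (g : M →ₗ[R] N) (hg : Function.Injective g) (P : Submodule R M) :
    Module.length R (N ⧸ P.map g) =
      Module.length R (M ⧸ P) + Module.length R (N ⧸ LinearMap.range g) := by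
  refine Module.length_eq_add_of_exact (P.mapQ (P.map g) g (Submodule.le_comap_map g P))
    (Submodule.factor (LinearMap.map_le_range)) ?_ (Submodule.factor_surjective _) ?_
  · rw [← LinearMap.ker_eq_bot, Submodule.ker_mapQ, Submodule.comap_map_eq_of_injective hg,
      ← le_bot_iff, Submodule.map_le_iff_le_comap]
    simp
  · rw [LinearMap.exact_iff, Submodule.range_mapQ, Submodule.factor, Submodule.ker_mapQ]
    simp

/-- The colength of `x M` in `M` does not change when `M` is embedded in a module in which it has
finite colength and on which `x` is regular. -/
theorem length_quotient_range_lsmul_eq {M N : Type*} [AddCommGroup M] [Module R M]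
    [AddCommGroup N] [Module R N] (f : M →ₗ[R] N) (hf : Function.Injective f)
    (hfin : Module.length R (N ⧸ LinearMap.range f) ≠ ⊤) {x : R} (hx : IsSMulRegular N x) :
    Module.length R (M ⧸ LinearMap.range (LinearMap.lsmul R M x)) =
      Module.length R (N ⧸ LinearMap.range (LinearMap.lsmul R N x)) := by
  have h1 := length_quotient_map f hf (LinearMap.range (LinearMap.lsmul R M x))
  have h2 := length_quotient_map (LinearMap.lsmul R N x) hx (LinearMap.range f)
  have h3 : (LinearMap.range (LinearMap.lsmul R M x)).map f =
      (LinearMap.range f).map (LinearMap.lsmul R N x) := by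
    rw [← LinearMap.range_comp, ← LinearMap.range_comp]
    congr 1
    ext m
    simp
  rw [h3, h2, add_comm] at h1
  exact (WithTop.add_right_cancel hfin h1).symm

theorem length_quotient_range_lsmul_self (x : R) :
    Module.length R (R ⧸ LinearMap.range (LinearMap.lsmul R R x)) =
      Module.length R (R ⧸ Ideal.span {x}) := by
  refine (Submodule.quotEquivOfEq _ _ ?_).length_eq
  ext r
  simp [Ideal.mem_span_singleton', mul_comm]

theorem length_le_spanFinrank_mul {M : Type*} [AddCommGroup M] [Module R M] [Module.Finite R M]
    (I : Ideal R) (hI : ∀ r ∈ I, ∀ m : M, r • m = 0) :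
    Module.length R M ≤ (⊤ : Submodule R M).spanFinrank * Module.length R (R ⧸ I) := by
  obtain ⟨s, hs, hspan⟩ := Submodule.FG.exists_span_finset_card_eq_spanFinrank
    (Module.Finite.fg_top (R := R) (M := M))
  let φ : (s → R ⧸ I) →ₗ[R] M := ∑ i : s, (I.liftQ (LinearMap.toSpanSingleton R M (i : M))
    fun r hr ↦ by simp [hI r hr]) ∘ₗ LinearMap.proj i
  have hφ : Function.Surjective φ := by
    classical
    rw [← LinearMap.range_eq_top, ← top_le_iff, ← hspan, Submodule.span_le]
    intro m hm
    refine ⟨Pi.single ⟨m, hm⟩ (Submodule.Quotient.mk 1), ?_⟩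
    simp only [φ, LinearMap.sum_apply, LinearMap.comp_apply, LinearMap.proj_apply]
    rw [Finset.sum_eq_single ⟨m, hm⟩]
    · simpa using! Submodule.liftQ_apply I (LinearMap.toSpanSingleton R M m) (1 : R)
    · intro b _ hb
      simp [hb]
    · simp
  refine (Module.length_le_of_surjective φ hφ).trans ?_
  rw [Module.length_pi_of_fintype, ← hs]
  simp

/-- By Nakayama, a minimal number of generators is the length of `M / 𝔪 M`. -/
theorem spanFinrank_le_length_quotient [IsLocalRing R] {M : Type*} [AddCommGroup M] [Module R M]
    [Module.Finite R M] (P : Submodule R M) (hP : P ≤ IsLocalRing.maximalIdeal R • ⊤) :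
    ((⊤ : Submodule R M).spanFinrank : ℕ∞) ≤ Module.length R (M ⧸ P) := by
  let 𝔪 := IsLocalRing.maximalIdeal R
  let : Field (R ⧸ 𝔪) := Ideal.Quotient.field _
  have h := IsLocalRing.spanFinrank_eq_finrank_quotient (⊤ : Submodule R M) Module.Finite.fg_top
  have h2 : Module.Finite (R ⧸ 𝔪)
      ((⊤ : Submodule R M) ⧸ 𝔪 • (⊤ : Submodule R (⊤ : Submodule R M))) :=
    Module.Finite.of_restrictScalars_finite R _ _
  rw [h, ← Module.length_eq_finrank, ← Module.length_eq_of_surjective (S := R) (R := R ⧸ 𝔪)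
    Ideal.Quotient.mk_surjective]
  let φ : M →ₗ[R] ((⊤ : Submodule R M) ⧸ 𝔪 • (⊤ : Submodule R (⊤ : Submodule R M))) :=
    Submodule.mkQ _ ∘ₗ (Submodule.topEquiv (R := R) (M := M)).symm.toLinearMap
  have hφ : Function.Surjective φ :=
    (Submodule.mkQ_surjective _).comp (Submodule.topEquiv (R := R) (M := M)).symm.surjective
  refine Module.length_le_of_surjective (P.liftQ φ (hP.trans ?_)) ?_
  · rw [Submodule.smul_le]
    intro r hr m _
    simp only [φ, LinearMap.mem_ker, LinearMap.comp_apply, map_smul, Submodule.mkQ_apply]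
    rw [← Submodule.Quotient.mk_smul, Submodule.Quotient.mk_eq_zero]
    exact Submodule.smul_mem_smul hr trivial
  · rw [← LinearMap.range_eq_top, Submodule.range_liftQ, LinearMap.range_eq_top]
    exact hφ

theorem isArtinianRing_quotient_of_pow_le [IsLocalRing R] [IsNoetherianRing R] {I : Ideal R}
    {n : ℕ} (h : IsLocalRing.maximalIdeal R ^ n ≤ I) : IsArtinianRing (R ⧸ I) := by
  rw [isArtinianRing_iff_isNoetherianRing_krullDimLE_zero]
  refine ⟨inferInstance, Ring.krullDimLE_zero_iff.2 fun P hP ↦ ?_⟩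
  have h1 : IsLocalRing.maximalIdeal R ≤ P.comap (Ideal.Quotient.mk I) :=
    (hP.comap _).le_of_pow_le (h.trans fun r hr ↦ by
      simp [Ideal.mem_comap, Ideal.Quotient.eq_zero_iff_mem.2 hr])
  have h2 : (P.comap (Ideal.Quotient.mk I)).IsMaximal := by
    rw [← (IsLocalRing.maximalIdeal.isMaximal R).eq_of_le (hP.comap _).ne_top h1]
    infer_instance
  exact (Ideal.map_comap_of_surjective _ Ideal.Quotient.mk_surjective P) ▸
    (Ideal.map_eq_top_or_isMaximal_of_surjective _ Ideal.Quotient.mk_surjective h2).resolve_left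
      (by rw [Ideal.map_comap_of_surjective _ Ideal.Quotient.mk_surjective]; exact hP.ne_top)

/-- In dimension one, the quotient by a non-zero-divisor has dimension at most zero, so is
Artinian. -/
theorem exists_pow_le_span_singleton [IsLocalRing R] [IsNoetherianRing R]
    (hdim : ringKrullDim R = 1) {x : R} (hx : x ∈ nonZeroDivisors R) :
    ∃ n, IsLocalRing.maximalIdeal R ^ n ≤ Ideal.span {x} := by
  have h1 := ringKrullDim_quotient_succ_le_of_nonZeroDivisor hx
  rw [hdim] at h1
  have : Ring.KrullDimLE 0 (R ⧸ Ideal.span {x}) := by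
    rw [Ring.krullDimLE_iff]
    exact (ENat.WithBot.add_le_add_one_right_iff).1 (by simpa using h1)
  have : IsArtinianRing (R ⧸ Ideal.span {x}) :=
    isArtinianRing_iff_isNoetherianRing_krullDimLE_zero.2 ⟨inferInstance, this⟩
  exact IsLocalRing.exists_maximalIdeal_pow_le_of_isArtinianRing_quotient _

theorem length_ne_top_of_pow_le_annihilator [IsLocalRing R] [IsNoetherianRing R] {M : Type*}
    [AddCommGroup M] [Module R M] [Module.Finite R M] (n : ℕ)
    (h : ∀ r ∈ IsLocalRing.maximalIdeal R ^ n, ∀ m : M, r • m = 0) :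
    Module.length R M ≠ ⊤ := by
  have hart : IsArtinianRing (R ⧸ IsLocalRing.maximalIdeal R ^ n) :=
    isArtinianRing_quotient_of_pow_le le_rfl
  have h1 : Module.length R (R ⧸ IsLocalRing.maximalIdeal R ^ n) ≠ ⊤ := by
    rw [Module.length_eq_of_surjective (S := R) (R := R ⧸ IsLocalRing.maximalIdeal R ^ n)
      Ideal.Quotient.mk_surjective]
    exact Module.length_ne_top
  exact ne_top_of_le_ne_top (WithTop.mul_ne_top (ENat.natCast_ne_top _) h1)
    (length_le_spanFinrank_mul _ h)

theorem length_quotient_ne_top [IsLocalRing R] [IsNoetherianRing R] {I : Ideal R} {n : ℕ}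
    (h : IsLocalRing.maximalIdeal R ^ n ≤ I) : Module.length R (R ⧸ I) ≠ ⊤ := by
  refine length_ne_top_of_pow_le_annihilator n fun r hr m ↦ ?_
  obtain ⟨m, rfl⟩ := Ideal.Quotient.mk_surjective m
  rw [← Ideal.Quotient.mk_eq_mk, ← Submodule.Quotient.mk_smul, Submodule.Quotient.mk_eq_zero]
  exact I.mul_mem_right _ (h hr)

theorem spanFinrank_le_length_quotient_span [IsLocalRing R] {M : Type*} [AddCommGroup M]
    [Module R M] [Module.Finite R M] {x : R}
    (hx : x ∈ IsLocalRing.maximalIdeal R)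
    (h : Module.length R (M ⧸ LinearMap.range (LinearMap.lsmul R M x)) =
      Module.length R (R ⧸ Ideal.span {x})) :
    ((⊤ : Submodule R M).spanFinrank : ℕ∞) ≤ Module.length R (R ⧸ Ideal.span {x}) := by
  rw [← h]
  refine spanFinrank_le_length_quotient _ ?_
  rintro _ ⟨m, rfl⟩
  exact Submodule.smul_mem_smul hx trivial

end Length

/-! ### The fibre ring and principal reductions -/

section Reduction

open IsLocalRing Polynomial

variable {R : Type*} [CommRing R]

/-- The fibre of the Rees algebra of `I` over `R ⧸ P`. When `I = P` it is the associated graded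
ring of `I`. -/
def FibreRing (I P : Ideal R) : Type _ :=
  reesAlgebra I ⧸ P.map (algebraMap R (reesAlgebra I))

noncomputable instance (I P : Ideal R) : CommRing (FibreRing I P) :=
  inferInstanceAs (CommRing (_ ⧸ P.map (algebraMap R (reesAlgebra I))))

noncomputable instance (I P : Ideal R) : Algebra R (FibreRing I P) :=
  inferInstanceAs (Algebra R (_ ⧸ P.map (algebraMap R (reesAlgebra I))))

noncomputable instance (I P : Ideal R) : Algebra (R ⧸ P) (FibreRing I P) :=
  inferInstanceAs (Algebra (R ⧸ P) (_ ⧸ P.map (algebraMap R (reesAlgebra I))))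

instance (I P : Ideal R) : IsScalarTower R (R ⧸ P) (FibreRing I P) :=
  inferInstanceAs (IsScalarTower R (R ⧸ P) (_ ⧸ P.map (algebraMap R (reesAlgebra I))))

/-- The quotient map from the Rees algebra to its fibre. -/
noncomputable def FibreRing.mk (I P : Ideal R) : reesAlgebra I →ₐ[R] FibreRing I P :=
  Ideal.Quotient.mkₐ R (P.map (algebraMap R (reesAlgebra I)))

/-- The map from `I ^ j` onto the part of degree `j` of the fibre ring. -/
noncomputable def FibreRing.ι (I P : Ideal R) (j : ℕ) : ↥(I ^ j) →ₗ[R] FibreRing I P :=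
  (mk I P).toLinearMap ∘ₗ
    { toFun := fun u ↦ ⟨monomial j (u : R), reesAlgebra.monomial_mem.2 u.2⟩
      map_add' := fun u v ↦ by ext1; simp
      map_smul' := fun r u ↦ by ext1; simp [smul_monomial] }

theorem FibreRing.ι_mul (I P : Ideal R) {i j l : ℕ} (h : i + j = l) (u : ↥(I ^ i)) (v : ↥(I ^ j))
    (huv : (u * v : R) ∈ I ^ l) :
    ι I P i u * ι I P j v = ι I P l ⟨u * v, huv⟩ := by
  subst h
  simp only [ι, LinearMap.comp_apply, AlgHom.toLinearMap_apply, ← map_mul]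
  congr 1
  ext1
  simp [monomial_mul_monomial]

theorem FibreRing.mem_of_ι_eq_zero (I P : Ideal R) {j : ℕ} {u : ↥(I ^ j)}
    (h : ι I P j u = 0) : (u : R) ∈ P * I ^ j := by
  have h1 : (⟨monomial j (u : R), reesAlgebra.monomial_mem.2 u.2⟩ : reesAlgebra I) ∈
      P.map (algebraMap R (reesAlgebra I)) := Ideal.Quotient.eq_zero_iff_mem.1 h
  suffices H : ∀ f ∈ P.map (algebraMap R (reesAlgebra I)), ∀ i, (f : R[X]).coeff i ∈ P * I ^ i by
    simpa using H _ h1 j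
  intro f hf
  refine Submodule.span_induction ?_ ?_ ?_ ?_ hf
  · rintro _ ⟨r, hr, rfl⟩ i
    change (C r).coeff i ∈ _
    rw [coeff_C]
    split_ifs with hi
    · subst hi; simpa using hr
    · exact zero_mem _
  · simp
  · intro f g _ _ hf hg i
    simpa using add_mem (hf i) (hg i)
  · intro a f _ hf i
    simp only [smul_eq_mul, MulMemClass.coe_mul, coeff_mul]
    refine sum_mem fun p hp ↦ ?_
    rw [← Finset.HasAntidiagonal.mem_antidiagonal.1 hp, pow_add, mul_left_comm]
    exact Ideal.mul_mem_mul ((mem_reesAlgebra_iff _ _).1 a.2 _) (hf _)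

/-- The part of degree `j` of the fibre ring, which is `I ^ j / P I ^ j`. It is defined as the
span of the image of `I ^ j`, which is that image by `FibreRing.mem_piece`. -/
noncomputable def FibreRing.piece (I P : Ideal R) (j : ℕ) : Submodule (R ⧸ P) (FibreRing I P) :=
  Submodule.span (R ⧸ P) (Set.range (ι I P j))

theorem FibreRing.mem_piece {I P : Ideal R} {j : ℕ} {a : FibreRing I P} :
    a ∈ piece I P j ↔ ∃ u, ι I P j u = a := by
  rw [piece, ← Submodule.restrictScalars_mem R,
    Submodule.restrictScalars_span R (R ⧸ P) Ideal.Quotient.mk_surjective, ← LinearMap.coe_range,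
    Submodule.span_eq, LinearMap.mem_range]

theorem FibreRing.piece_succ (I P : Ideal R) (j : ℕ) :
    piece I P (j + 1) = piece I P 1 * piece I P j := by
  apply le_antisymm
  · rw [piece, Submodule.span_le]
    rintro _ ⟨u, rfl⟩
    suffices H : I ^ (j + 1) ≤ (((piece I P 1 * piece I P j).restrictScalars R).comap
        (ι I P (j + 1))).map (I ^ (j + 1)).subtype by
      obtain ⟨u', hu', h⟩ := H u.2
      obtain rfl : u' = u := Subtype.ext h
      exact hu'
    conv_lhs => rw [pow_succ']
    rw [Ideal.mul_le]
    intro r hr s hs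
    have hrs : r * s ∈ I ^ (j + 1) := by rw [pow_succ']; exact Ideal.mul_mem_mul hr hs
    refine ⟨⟨r * s, hrs⟩, ?_, rfl⟩
    change ι I P (j + 1) _ ∈ piece I P 1 * piece I P j
    rw [← ι_mul I P (add_comm 1 j) ⟨r, by simpa using hr⟩ ⟨s, hs⟩]
    exact Submodule.mul_mem_mul (mem_piece.2 ⟨_, rfl⟩) (mem_piece.2 ⟨_, rfl⟩)
  · rw [Submodule.mul_le]
    intro a ha b hb
    obtain ⟨u, rfl⟩ := mem_piece.1 ha
    obtain ⟨v, rfl⟩ := mem_piece.1 hb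
    rw [ι_mul I P (add_comm 1 j) u v
      (by rw [pow_succ']; exact Ideal.mul_mem_mul (by simpa using u.2) v.2)]
    exact mem_piece.2 ⟨_, rfl⟩

theorem FibreRing.piece_zero (I P : Ideal R) : piece I P 0 = 1 := by
  have h1 : ι I P 0 ⟨1, by simp⟩ = 1 := by
    simp only [ι, LinearMap.comp_apply, AlgHom.toLinearMap_apply]
    rw [← map_one (mk I P)]
    congr 1
  apply le_antisymm
  · intro a ha
    obtain ⟨u, rfl⟩ := mem_piece.1 ha
    have hu : u = (u : R) • (⟨1, by simp⟩ : ↥(I ^ 0)) := by ext; simp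
    rw [hu, map_smul, h1]
    exact Submodule.mem_one.2 ⟨Ideal.Quotient.mk P u, by
      rw [← Ideal.Quotient.algebraMap_eq, ← IsScalarTower.algebraMap_apply, Algebra.smul_def,
        mul_one]⟩
  · rw [Submodule.one_le, ← h1]
    exact mem_piece.2 ⟨_, rfl⟩

theorem FibreRing.piece_one_pow (I P : Ideal R) (j : ℕ) : piece I P 1 ^ j = piece I P j := by
  induction j with
  | zero => rw [pow_zero, piece_zero]
  | succ j ih => rw [pow_succ', ih, ← piece_succ]

theorem FibreRing.piece_eq_span (I P : Ideal R) (j : ℕ) (hI : (I ^ j).FG) :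
    ∃ s : Finset (FibreRing I P), s.card ≤ (I ^ j).spanFinrank ∧
      piece I P j = Submodule.span (R ⧸ P) (s : Set (FibreRing I P)) := by
  classical
  have : Module.Finite R ↥(I ^ j) := Module.Finite.iff_fg.2 hI
  obtain ⟨s, hs, hspan⟩ := Submodule.FG.exists_span_finset_card_eq_spanFinrank
    (Module.Finite.fg_top (R := R) (M := ↥(I ^ j)))
  refine ⟨s.image (ι I P j), ?_, ?_⟩
  · rw [← Submodule.spanFinrank_top, ← hs]
    exact Finset.card_image_le
  · ext a
    rw [← Submodule.restrictScalars_mem R (Submodule.span _ _),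
      Submodule.restrictScalars_span R (R ⧸ P) Ideal.Quotient.mk_surjective, Finset.coe_image,
      ← Submodule.map_span, hspan, mem_piece]
    simp

/-- If `𝔪 ^ (n + 1)` has at most `n + 1` generators, some `x ∈ 𝔪` satisfies
`𝔪 ^ (n + 1) = x 𝔪 ^ n`: the theorem of Eakin and Sathaye in the associated graded ring, lifted to `R` by Nakayama. -/
theorem exists_pow_succ_le_span_mul_pow [IsLocalRing R] [IsNoetherianRing R]
    [Infinite (ResidueField R)] {n : ℕ} (hn : (maximalIdeal R ^ (n + 1)).spanFinrank ≤ n + 1) :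
    ∃ x ∈ maximalIdeal R,
      maximalIdeal R ^ (n + 1) ≤ Ideal.span {x} * maximalIdeal R ^ n := by
  let 𝔪 := maximalIdeal R
  let : Field (R ⧸ 𝔪) := Ideal.Quotient.field _
  have : Infinite (R ⧸ 𝔪) := ‹Infinite (ResidueField R)›
  have hfg (j : ℕ) : (FibreRing.piece 𝔪 𝔪 j).FG := by
    obtain ⟨s, -, hs⟩ := FibreRing.piece_eq_span 𝔪 𝔪 j (IsNoetherian.noetherian _)
    exact ⟨s, hs.symm⟩
  obtain ⟨s, hs, hspan⟩ := FibreRing.piece_eq_span 𝔪 𝔪 (n + 1) (IsNoetherian.noetherian _)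
  have hrank : Module.finrank (R ⧸ 𝔪) (FibreRing.piece 𝔪 𝔪 (n + 1)) ≤ n + 1 := by
    rw [hspan]
    exact (finrank_span_finset_le_card s).trans (hs.trans hn)
  obtain ⟨y, hy, hle⟩ := exists_mul_pow_eq_of_finrank_le (k := R ⧸ 𝔪) (FibreRing.piece 𝔪 𝔪 1)
    (hfg 1) n 1 (by
      rw [FibreRing.piece_one_pow]
      have : Module.Finite (R ⧸ 𝔪) (FibreRing.piece 𝔪 𝔪 (n + 1)) := Module.Finite.iff_fg.2 (hfg _)
      exact (Submodule.finrank_map_le _ _).trans hrank)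
  obtain ⟨x, rfl⟩ := FibreRing.mem_piece.1 hy
  have hx : (x : R) ∈ 𝔪 := by simpa using x.2
  refine ⟨x, hx, ?_⟩
  refine Submodule.le_of_le_smul_of_le_jacobson_bot (I := 𝔪) (IsNoetherian.noetherian _)
    (maximalIdeal_le_jacobson _) fun u hu ↦ ?_
  obtain ⟨_, hv, hv2⟩ := hle ⟨FibreRing.ι 𝔪 𝔪 (n + 1) ⟨u, hu⟩, by
    rw [FibreRing.piece_one_pow]; exact FibreRing.mem_piece.2 ⟨_, rfl⟩, rfl⟩
  rw [FibreRing.piece_one_pow] at hv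
  obtain ⟨v, rfl⟩ := FibreRing.mem_piece.1 hv
  have hxv : (x * v : R) ∈ 𝔪 ^ (n + 1) := by rw [pow_succ']; exact Ideal.mul_mem_mul hx v.2
  simp only [LinearMap.mulLeft_apply, one_mul] at hv2
  rw [FibreRing.ι_mul 𝔪 𝔪 (add_comm 1 n) x v hxv, eq_comm, ← sub_eq_zero, ← map_sub] at hv2
  have := FibreRing.mem_of_ι_eq_zero 𝔪 𝔪 hv2
  rw [← add_sub_cancel (x * v : R) u]
  exact Submodule.add_mem_sup (Ideal.mul_mem_mul (Ideal.mem_span_singleton_self _) v.2) this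

end Reduction

/-! ### Bounded degree of integral dependence -/

section Normalization

open IsLocalRing Polynomial

variable {R : Type*} [CommRing R] [IsLocalRing R] [IsNoetherianRing R]

theorem length_quotient_span_ne_top (hdim : ringKrullDim R = 1) {x : R}
    (hx : x ∈ nonZeroDivisors R) : Module.length R (R ⧸ Ideal.span {x}) ≠ ⊤ :=
  let ⟨_, hn⟩ := exists_pow_le_span_singleton hdim hx
  length_quotient_ne_top hn

theorem isSMulRegular_self {R : Type*} [CommRing R] {x : R} (hx : x ∈ nonZeroDivisors R) :
    IsSMulRegular R x := fun a b h ↦ by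
  simpa [mul_cancel_left_mem_nonZeroDivisors hx] using h

/-- The number of generators of `𝔪 ^ n` is bounded independently of `n`. -/
theorem spanFinrank_pow_le {x : R} (hx : x ∈ nonZeroDivisors R)
    (hxm : x ∈ maximalIdeal R) (n : ℕ) :
    ((maximalIdeal R ^ n).spanFinrank : ℕ∞) ≤ Module.length R (R ⧸ Ideal.span {x}) := by
  rw [← Submodule.spanFinrank_top]
  refine spanFinrank_le_length_quotient_span hxm ?_
  rw [← length_quotient_range_lsmul_self]
  refine length_quotient_range_lsmul_eq (maximalIdeal R ^ n).subtype
    (Submodule.injective_subtype _) ?_ (isSMulRegular_self hx)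
  rw [Submodule.range_subtype]
  exact length_quotient_ne_top le_rfl

variable {Q : Type*} [CommRing Q] [Algebra R Q] [IsLocalization (nonZeroDivisors R) Q]

/-- The number of generators of `R[β]` as a module is bounded independently of `β`, because `R[β]`
is finite over `R` with a common denominator. -/
theorem spanFinrank_adjoin_singleton_le (hdim : ringKrullDim R = 1) {x : R}
    (hx : x ∈ nonZeroDivisors R) (hxm : x ∈ maximalIdeal R) {β : Q} (hβ : IsIntegral R β) :
    ((⊤ : Submodule R (Algebra.adjoin R {β})).spanFinrank : ℕ∞) ≤
      Module.length R (R ⧸ Ideal.span {x}) := by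
  have : Module.Finite R (Algebra.adjoin R {β}) := Module.Finite.iff_fg.2 hβ.fg_adjoin_singleton
  refine spanFinrank_le_length_quotient_span hxm ?_
  rw [← length_quotient_range_lsmul_self]
  refine (length_quotient_range_lsmul_eq (Algebra.linearMap R (Algebra.adjoin R {β})) ?_ ?_ ?_).symm
  · intro a b h
    exact IsLocalization.injective Q le_rfl (congrArg (algebraMap (Algebra.adjoin R {β}) Q) h)
  · obtain ⟨T, hT⟩ := hβ.fg_adjoin_singleton
    obtain ⟨s, hs⟩ := IsLocalization.exist_integer_multiples_of_finset (nonZeroDivisors R) T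
    obtain ⟨n, hn⟩ := exists_pow_le_span_singleton hdim s.2
    have hs' : ∀ b ∈ Algebra.adjoin R {β}, ∃ r : R, algebraMap R Q r = (s : R) • b := by
      intro b hb
      rw [← Subalgebra.mem_toSubmodule] at hb
      rw [← hT] at hb
      induction hb using Submodule.span_induction with
      | mem b hb => exact hs b hb
      | zero => exact ⟨0, by simp⟩
      | add a b _ _ ha hb =>
        obtain ⟨r, hr⟩ := ha
        obtain ⟨t, ht⟩ := hb
        exact ⟨r + t, by simp [hr, ht]⟩
      | smul c b _ hb =>
        obtain ⟨r, hr⟩ := hb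
        exact ⟨c * r, by rw [map_mul, hr, smul_comm, Algebra.smul_def c]⟩
    refine length_ne_top_of_pow_le_annihilator n fun r hr b ↦ ?_
    obtain ⟨b, rfl⟩ := Submodule.Quotient.mk_surjective _ b
    obtain ⟨t, rfl⟩ := Ideal.mem_span_singleton'.1 (hn hr)
    obtain ⟨u, hu⟩ := hs' b b.2
    rw [← Submodule.Quotient.mk_smul, Submodule.Quotient.mk_eq_zero]
    refine ⟨t * u, Subtype.ext ?_⟩
    change algebraMap R Q (t * u) = (t * (s : R)) • (b : Q)
    rw [map_mul, hu, mul_smul, Algebra.smul_def t]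
  · intro a b h
    ext
    have h2 : x • (a : Q) = x • (b : Q) := congrArg Subtype.val h
    rw [Algebra.smul_def, Algebra.smul_def] at h2
    exact (IsLocalization.map_units Q (⟨x, hx⟩ : nonZeroDivisors R)).mul_left_cancel h2

/-- If `b / s` is integral over `R`, a power of `b` with exponent independent of `b` and `s` is
divisible by `s`: the minimal polynomial of `b / s` has bounded degree, and clearing denominators
turns it into a monic equation for `b` whose other coefficients are divisible by `s`. -/
theorem pow_mem_span_of_isIntegral (hdim : ringKrullDim R = 1) {x : R}
    (hx : x ∈ nonZeroDivisors R) (hxm : x ∈ maximalIdeal R) {β : Q} (hβ : IsIntegral R β)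
    {b s : R} (hb : algebraMap R Q b = algebraMap R Q s * β) :
    b ^ (Module.length R (R ⧸ Ideal.span {x})).toNat ∈ Ideal.span {s} := by
  have : Module.Finite R (Algebra.adjoin R {β}) := Module.Finite.iff_fg.2 hβ.fg_adjoin_singleton
  let β' : Algebra.adjoin R {β} := ⟨β, Algebra.self_mem_adjoin_singleton R β⟩
  let p := minpoly R β'
  have hdeg : p.natDegree ≤ (Module.length R (R ⧸ Ideal.span {x})).toNat := by
    refine (minpoly.natDegree_le_spanFinrank R β').trans ?_
    have := ENat.toNat_le_toNat (spanFinrank_adjoin_singleton_le hdim hx hxm hβ)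
      (length_quotient_span_ne_top hdim hx)
    simpa using this
  have hmonic : p.Monic := minpoly.monic (Algebra.IsIntegral.isIntegral β')
  have h0 : aeval β p = 0 := by
    have := congrArg (algebraMap (Algebra.adjoin R {β}) Q) (minpoly.aeval R β')
    rwa [← aeval_algebraMap_apply, map_zero] at this
  have h1 : aeval b (p.scaleRoots s) = 0 := by
    apply IsLocalization.injective Q (le_refl (nonZeroDivisors R))
    rw [← aeval_algebraMap_apply, hb, map_zero]
    exact scaleRoots_aeval_eq_zero h0
  refine Ideal.mem_of_dvd _ (pow_dvd_pow b hdeg) ?_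
  rw [coe_aeval_eq_eval, eval_eq_sum_range, Finset.sum_range_succ, natDegree_scaleRoots,
    coeff_scaleRoots_natDegree, hmonic.leadingCoeff, one_mul] at h1
  rw [← neg_eq_of_add_eq_zero_right h1, neg_mem_iff]
  refine sum_mem fun i hi ↦ ?_
  rw [coeff_scaleRoots]
  refine Ideal.mul_mem_right _ _ (Ideal.mul_mem_left _ _ ?_)
  exact Ideal.pow_mem_of_mem _ (Ideal.mem_span_singleton_self s) _
    (Nat.sub_pos_of_lt (Finset.mem_range.1 hi))

end Normalization

/-! ### Chevalley's compactness argument -/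

section Chevalley

variable {R : Type*} [CommRing R]

theorem exists_forall_sup_eq_of_isArtinianRing (K : Ideal R) [IsArtinianRing (R ⧸ K)]
    {J : ℕ → Ideal R} (hJ : Antitone J) : ∃ N, ∀ n ≥ N, J n ⊔ K = J N ⊔ K := by
  obtain ⟨N, hN⟩ := IsArtinian.monotone_stabilizes (R := R ⧸ K) (M := R ⧸ K)
    ⟨fun n ↦ OrderDual.toDual ((J n).map (Ideal.Quotient.mk K)),
      fun a b h ↦ Ideal.map_mono (hJ h)⟩
  refine ⟨N, fun n hn ↦ ?_⟩
  have h : (J N).map (Ideal.Quotient.mk K) = (J n).map (Ideal.Quotient.mk K) := hN n hn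
  have := congrArg (Ideal.comap (Ideal.Quotient.mk K)) h
  rwa [Ideal.comap_map_of_surjective _ Ideal.Quotient.mk_surjective,
    Ideal.comap_map_of_surjective _ Ideal.Quotient.mk_surjective, ← RingHom.ker_eq_comap_bot,
    Ideal.mk_ker, eq_comm] at this

/-- A form of Chevalley's theorem. If `J` is decreasing and no `J n` lies in `K`, the Artinian
quotients `R ⧸ I ^ k` allow a compatible choice of elements of `J n + I ^ n` outside `K`, hence a
non-zero element of the completion; the bound `d` makes it nilpotent. -/
theorem exists_le_of_isReduced_adicCompletion {I : Ideal R} [IsReduced (AdicCompletion I R)]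
    (hart : ∀ k, IsArtinianRing (R ⧸ I ^ k)) {J : ℕ → Ideal R} (hJ : Antitone J) (d : ℕ)
    (hd : ∀ n, ∀ b ∈ J n, b ^ d ∈ I ^ n) {K : Ideal R} {k₀ : ℕ} (hK : I ^ k₀ ≤ K) :
    ∃ n, J n ≤ K := by
  by_contra! hcon
  -- `J (N k) + I ^ k` is the stable value of the decreasing sequence `n ↦ J n + I ^ k`
  choose N hN using fun k ↦ exists_forall_sup_eq_of_isArtinianRing (I ^ k) hJ
  have hle (k n : ℕ) : J (N k) ⊔ I ^ k ≤ J n ⊔ I ^ k := by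
    rcases le_total (N k) n with h | h
    · exact (hN k n h).ge
    · exact sup_le_sup_right (hJ h) _
  have step (k : ℕ) (t : R) (ht : t ∈ J (N k) ⊔ I ^ k) :
      ∃ t' ∈ J (N (k + 1)) ⊔ I ^ (k + 1), t - t' ∈ I ^ k := by
    obtain ⟨j, hj, e, he, rfl⟩ := Submodule.mem_sup.1 (hle k (N (k + 1)) ht)
    exact ⟨j, Ideal.mem_sup_left hj, by simpa using he⟩
  choose! φ hφ using step
  obtain ⟨t₀, ht₀, ht₀K⟩ := Set.not_subset.1 (hcon (N k₀))
  let f : ℕ → R := fun i ↦ Nat.rec t₀ (fun i t ↦ φ (k₀ + i) t) i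
  have hf (i : ℕ) : f i ∈ J (N (k₀ + i)) ⊔ I ^ (k₀ + i) := by
    induction i with
    | zero => exact Ideal.mem_sup_left ht₀
    | succ i ih => exact (hφ (k₀ + i) _ ih).1
  have hf2 (i : ℕ) : f i - f (i + 1) ∈ I ^ (k₀ + i) := (hφ (k₀ + i) _ (hf i)).2
  have hf0 (i : ℕ) : f 0 - f i ∈ I ^ k₀ := by
    induction i with
    | zero => simp
    | succ i ih => simpa using add_mem ih (Ideal.pow_le_pow_right (Nat.le_add_right _ _) (hf2 i))
  let s : AdicCompletion.AdicCauchySequence I R := .mk I R f fun i ↦ by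
    rw [SModEq.sub_mem, smul_eq_mul, Ideal.mul_top]
    exact Ideal.pow_le_pow_right (Nat.le_add_left _ _) (hf2 i)
  have hs : AdicCompletion.mkₐ I s = 0 := by
    -- the exponent `d + 1` is used because `d` may be zero
    refine (pow_eq_zero_iff d.succ_ne_zero).1 (AdicCompletion.ext_evalₐ fun i ↦ ?_)
    rw [map_pow, AdicCompletion.evalₐ_mkₐ, map_zero, ← map_pow, Ideal.Quotient.eq_zero_iff_mem]
    change f i ^ (d + 1) ∈ _
    have h1 : f i ∈ J i ⊔ I ^ i :=
      sup_le_sup (le_refl (J i)) (Ideal.pow_le_pow_right (Nat.le_add_left i k₀))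
        (hle (k₀ + i) i (hf i))
    obtain ⟨j, hj, e, he, hje⟩ := Submodule.mem_sup.1 h1
    rw [← hje, pow_succ]
    refine Ideal.mul_mem_right _ _ ?_
    rw [← Ideal.Quotient.eq_zero_iff_mem, map_pow, map_add, Ideal.Quotient.eq_zero_iff_mem.2 he,
      add_zero, ← map_pow, Ideal.Quotient.eq_zero_iff_mem]
    exact hd i j hj
  have h2 : f k₀ ∈ I ^ k₀ := by
    have := congrArg (AdicCompletion.evalₐ I k₀) hs
    rwa [AdicCompletion.evalₐ_mkₐ, map_zero, Ideal.Quotient.eq_zero_iff_mem] at this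
  have h3 : f 0 ∈ I ^ k₀ := by simpa using add_mem (hf0 k₀) h2
  exact ht₀K (hK h3)

end Chevalley

/-! ### The conductor contains a power of the maximal ideal -/

section Conductor

open IsLocalRing

variable {R : Type*} [CommRing R] [IsLocalRing R] [IsNoetherianRing R]

theorem mem_conductorIdeal {R : Type*} [CommRing R] {r : R} :
    r ∈ LocalRingInvariants.conductorIdeal R ↔ ∀ β : FractionRing R, IsIntegral R β →
      ∃ t : R, algebraMap R (FractionRing R) t = algebraMap R (FractionRing R) r * β := by
  simp only [LocalRingInvariants.conductorIdeal, Submodule.mem_colon, Submodule.mem_one,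
    Algebra.smul_def]
  rfl

theorem exists_pow_mem_conductorIdeal (hdim : ringKrullDim R = 1)
    (hAU : LocalRingInvariants.IsAnalyticallyUnramified R) {x : R} (hx : x ∈ nonZeroDivisors R)
    (hxm : x ∈ maximalIdeal R) : ∃ n, x ^ n ∈ LocalRingInvariants.conductorIdeal R := by
  have : IsReduced (AdicCompletion (maximalIdeal R) R) := hAU
  let Q := FractionRing R
  have hxu : IsUnit (algebraMap R Q x) := IsLocalization.map_units Q (⟨x, hx⟩ : nonZeroDivisors R)
  -- the contraction to `R` of `x ^ n • R̄`, where `R̄` is the normalization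
  let J : ℕ → Ideal R := fun n ↦ ((LocalRingInvariants.normalization R).toSubmodule.map
    (LinearMap.mulLeft R (algebraMap R Q (x ^ n)))).comap (Algebra.linearMap R Q)
  have hJmem {n : ℕ} {b : R} : b ∈ J n ↔
      ∃ β : Q, IsIntegral R β ∧ algebraMap R Q (x ^ n) * β = algebraMap R Q b := Iff.rfl
  have hJ : Antitone J := by
    intro m n hmn b hb
    obtain ⟨β, hβ, hb⟩ := hJmem.1 hb
    refine hJmem.2 ⟨algebraMap R Q (x ^ (n - m)) * β, isIntegral_algebraMap.mul hβ, ?_⟩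
    rw [← mul_assoc, ← map_mul, ← pow_add, Nat.add_sub_of_le hmn, hb]
  obtain ⟨k, hk⟩ := exists_pow_le_span_singleton hdim hx
  obtain ⟨n, hn⟩ := exists_le_of_isReduced_adicCompletion
    (fun k ↦ isArtinianRing_quotient_of_pow_le (le_refl (maximalIdeal R ^ k))) hJ
    (Module.length R (R ⧸ Ideal.span {x})).toNat (fun n b hb ↦ by
      obtain ⟨β, hβ, hb⟩ := hJmem.1 hb
      have := pow_mem_span_of_isIntegral hdim hx hxm hβ hb.symm
      exact (Ideal.span_singleton_le_iff_mem _).2 (Ideal.pow_mem_pow hxm n) this) hk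
  refine ⟨n, mem_conductorIdeal.2 fun β hβ ↦ ?_⟩
  -- the least power of `x` carrying `β` into `R`
  have hex : ∃ i, ∃ t : R, algebraMap R Q t = algebraMap R Q (x ^ i) * β := by
    obtain ⟨⟨a, s⟩, hs⟩ := IsLocalization.surj (nonZeroDivisors R) β
    obtain ⟨i, hi⟩ := exists_pow_le_span_singleton hdim s.2
    obtain ⟨c, hc⟩ := Ideal.mem_span_singleton'.1 (hi (Ideal.pow_mem_pow hxm i))
    refine ⟨i, c * a, ?_⟩
    rw [← hc, map_mul, map_mul, ← hs]
    ring
  classical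
  obtain ⟨t, ht⟩ := Nat.find_spec hex
  rcases le_or_gt (Nat.find hex) n with hle | hlt
  · refine ⟨x ^ (n - Nat.find hex) * t, ?_⟩
    rw [map_mul, ht, ← mul_assoc, ← map_mul, ← pow_add, Nat.sub_add_cancel hle]
  · -- otherwise `x ^ i * β` with `i > n` minimal lies in `J n`, so is divisible by `x` in `R`
    exfalso
    obtain ⟨i, hi⟩ : ∃ i, Nat.find hex = i + 1 := Nat.exists_eq_succ_of_ne_zero (by omega)
    rw [hi] at ht hlt
    obtain ⟨r, hr⟩ := Ideal.mem_span_singleton'.1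
      (hn (hJ hlt.le (hJmem.2 ⟨β, hβ, ht.symm⟩)))
    refine Nat.find_min hex (m := i) (by omega) ⟨r, hxu.mul_left_cancel ?_⟩
    rw [← map_mul, mul_comm x, hr, ht, pow_succ', map_mul, mul_assoc]

theorem length_quotient_conductorIdeal_ne_top (hdim : ringKrullDim R = 1)
    (hAU : LocalRingInvariants.IsAnalyticallyUnramified R) {x : R} (hx : x ∈ nonZeroDivisors R)
    (hxm : x ∈ maximalIdeal R) :
    Module.length R (R ⧸ LocalRingInvariants.conductorIdeal R) ≠ ⊤ := by
  obtain ⟨n, hn⟩ := exists_pow_mem_conductorIdeal hdim hAU hx hxm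
  obtain ⟨k, hk⟩ := exists_pow_le_span_singleton hdim (pow_mem hx n)
  exact length_quotient_ne_top (hk.trans ((Ideal.span_singleton_le_iff_mem _).2 hn))

end Conductor

/-! ### The multiplicity as the colength of a minimal reduction -/

section MinimalReduction

open IsLocalRing

variable {R : Type*} [CommRing R] [IsLocalRing R]

theorem exists_mem_nonZeroDivisors (hdim : ringKrullDim R = 1)
    (hCM : LocalRingInvariants.IsCohenMacaulay R) :
    ∃ z ∈ maximalIdeal R, z ∈ nonZeroDivisors R := by
  obtain ⟨rs, hm, hreg, hlen⟩ := hCM.exists_isRegular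
  rw [hdim] at hlen
  have hlen1 : rs.length = 1 := by exact_mod_cast hlen
  obtain ⟨z, rfl⟩ := List.length_eq_one_iff.1 hlen1
  refine ⟨z, hm z (by simp), mem_nonZeroDivisors_iff_right.2 fun a ha ↦ ?_⟩
  refine ((RingTheory.Sequence.isRegular_cons_iff R z []).1 hreg).1 ?_
  simpa [mul_comm] using ha

/-- A power of the non-zero-divisor `z` is a multiple of `x`. -/
theorem mem_nonZeroDivisors_of_pow_succ_le {x z : R} (hz : z ∈ nonZeroDivisors R)
    (hzm : z ∈ maximalIdeal R) {n : ℕ}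
    (h : maximalIdeal R ^ (n + 1) ≤ Ideal.span {x} * maximalIdeal R ^ n) :
    x ∈ nonZeroDivisors R := by
  have hzx : z ^ (n + 1) ∈ Ideal.span {x} :=
    Ideal.mul_le_left (J := maximalIdeal R ^ n) (h (Ideal.pow_mem_pow hzm (n + 1)))
  obtain ⟨a, ha⟩ := Ideal.mem_span_singleton'.1 hzx
  have := pow_mem hz (n + 1)
  rw [← ha] at this
  exact (mul_mem_nonZeroDivisors.1 this).2

/-- The powers of `𝔪` have boundedly many generators, so `𝔪 ^ (n + 1)` has at most `n + 1` of them
for large `n`. -/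
theorem exists_minimalReduction [IsNoetherianRing R] [Infinite (ResidueField R)]
    (hdim : ringKrullDim R = 1) {z : R}
    (hz : z ∈ nonZeroDivisors R) (hzm : z ∈ maximalIdeal R) :
    ∃ x ∈ maximalIdeal R, x ∈ nonZeroDivisors R ∧
      ∃ n, maximalIdeal R ^ (n + 1) ≤ Ideal.span {x} * maximalIdeal R ^ n := by
  let n := (Module.length R (R ⧸ Ideal.span {z})).toNat
  have hn : (maximalIdeal R ^ (n + 1)).spanFinrank ≤ n + 1 := by
    have := ENat.toNat_le_toNat (spanFinrank_pow_le hz hzm (n + 1))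
      (length_quotient_span_ne_top hdim hz)
    rw [ENat.toNat_natCast] at this
    exact this.trans n.le_succ
  obtain ⟨x, hxm, hx⟩ := exists_pow_succ_le_span_mul_pow hn
  exact ⟨x, hxm, mem_nonZeroDivisors_of_pow_succ_le hz hzm hx, n, hx⟩

variable {x : R} {n : ℕ}

theorem length_quotient_pow_add (hx : x ∈ nonZeroDivisors R) (hxm : x ∈ maximalIdeal R)
    (h : maximalIdeal R ^ (n + 1) ≤ Ideal.span {x} * maximalIdeal R ^ n) (i : ℕ) :
    Module.length R (R ⧸ maximalIdeal R ^ (n + i)) = Module.length R (R ⧸ maximalIdeal R ^ n) +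
      i * Module.length R (R ⧸ Ideal.span {x}) := by
  induction i with
  | zero => simp
  | succ i ih =>
    have h1 : maximalIdeal R ^ (n + (i + 1)) =
        Submodule.map (LinearMap.lsmul R R x) (maximalIdeal R ^ (n + i)) := by
      apply le_antisymm
      · rw [← add_assoc, add_right_comm, pow_add]
        intro u hu
        have := Ideal.mul_mono_left h hu
        rw [mul_assoc, ← pow_add, Ideal.mem_span_singleton_mul] at this
        exact this
      · rintro _ ⟨u, hu, rfl⟩
        rw [← add_assoc, pow_succ']
        exact Ideal.mul_mem_mul hxm hu
    rw [h1, length_quotient_map (LinearMap.lsmul R R x) (isSMulRegular_self hx), ih,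
      length_quotient_range_lsmul_self,
      add_assoc]
    push_cast
    rw [add_mul, one_mul]

variable [IsNoetherianRing R]

/-- The multiplicity is the colength of a minimal reduction `x`, because `𝔪 ^ (j + 1) = x 𝔪 ^ j`
for large `j` makes `ℓ(R / 𝔪 ^ j)` grow by `ℓ(R / x R)` at each step. -/
theorem tendsto_normalizedHilbertSamuel (hdim : ringKrullDim R = 1) (hx : x ∈ nonZeroDivisors R)
    (hxm : x ∈ maximalIdeal R)
    (h : maximalIdeal R ^ (n + 1) ≤ Ideal.span {x} * maximalIdeal R ^ n) :
    Tendsto (LocalRingInvariants.normalizedHilbertSamuel R) atTop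
      (𝓝 ((Module.length R (R ⧸ Ideal.span {x})).toNat : ℝ)) := by
  set e := (Module.length R (R ⧸ Ideal.span {x})).toNat with he
  set a := (Module.length R (R ⧸ maximalIdeal R ^ n)).toNat with ha
  have hd : LocalRingInvariants.dim R = 1 := by
    rw [LocalRingInvariants.dim, hdim]; rfl
  have hlen (i : ℕ) : (Module.length R (R ⧸ maximalIdeal R ^ (n + i))).toNat = a + i * e := by
    have hmul : (i : ℕ∞) * Module.length R (R ⧸ Ideal.span {x}) ≠ ⊤ :=
      WithTop.mul_ne_top (ENat.natCast_ne_top i) (length_quotient_span_ne_top hdim hx)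
    rw [length_quotient_pow_add hx hxm h,
      ENat.toNat_add (length_quotient_ne_top (le_refl (maximalIdeal R ^ n))) hmul,
      ENat.toNat_mul, ENat.toNat_natCast]
  have hlim : Tendsto (fun j : ℕ ↦ (e : ℝ) + ((a : ℝ) - n * e) * (j : ℝ)⁻¹) atTop (𝓝 e) := by
    simpa using (tendsto_inv_atTop_nhds_zero_nat (𝕜 := ℝ)).const_mul ((a : ℝ) - n * e)
      |>.const_add (e : ℝ)
  refine hlim.congr' ?_
  filter_upwards [eventually_ge_atTop (n + 1)] with j hj
  obtain ⟨i, rfl⟩ := Nat.exists_eq_add_of_le (Nat.le_of_succ_le hj)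
  have hj0 : ((n + i : ℕ) : ℝ) ≠ 0 := by norm_cast; omega
  rw [LocalRingInvariants.normalizedHilbertSamuel, hd, hlen, Nat.factorial_one, pow_one]
  field_simp
  push_cast
  ring

/-- A minimal reduction `x` generates the extension of `𝔪` to the normalization: multiplication by
`y / x` preserves `𝔪 ^ n`. -/
theorem exists_isIntegral_mul_eq {Q : Type*} [CommRing Q] [Algebra R Q]
    [IsLocalization (nonZeroDivisors R) Q] (hx : x ∈ nonZeroDivisors R)
    (hxm : x ∈ maximalIdeal R)
    (h : maximalIdeal R ^ (n + 1) ≤ Ideal.span {x} * maximalIdeal R ^ n) {y : R}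
    (hy : y ∈ maximalIdeal R) :
    ∃ β : Q, IsIntegral R β ∧ algebraMap R Q x * β = algebraMap R Q y := by
  let β : Q := IsLocalization.mk' Q y (⟨x, hx⟩ : nonZeroDivisors R)
  have hβ : algebraMap R Q x * β = algebraMap R Q y := IsLocalization.mk'_spec' Q y ⟨x, hx⟩
  have hxu : IsUnit (algebraMap R Q x) := IsLocalization.map_units Q (⟨x, hx⟩ : nonZeroDivisors R)
  refine ⟨β, ?_, hβ⟩
  let N : Submodule R Q := Submodule.map (Algebra.linearMap R Q) (maximalIdeal R ^ n)
  have hβN : ∀ u ∈ N, β * u ∈ N := by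
    rintro _ ⟨u, hu, rfl⟩
    have hyu : y * u ∈ maximalIdeal R ^ (n + 1) := by
      rw [pow_succ']; exact Ideal.mul_mem_mul hy hu
    obtain ⟨v, hv, hv2⟩ := Ideal.mem_span_singleton_mul.1 (h hyu)
    refine ⟨v, hv, hxu.mul_left_cancel ?_⟩
    rw [Algebra.linearMap_apply, Algebra.linearMap_apply, ← map_mul, hv2, map_mul, ← mul_assoc, hβ]
  -- the elements preserving `N` form a subalgebra, which embeds in `N` by evaluation at `x ^ n`
  let S : Subalgebra R Q :=
    { carrier := {b | ∀ u ∈ N, b * u ∈ N}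
      mul_mem' := fun {a b} ha hb u hu ↦ by rw [mul_assoc]; exact ha _ (hb u hu)
      add_mem' := fun {a b} ha hb u hu ↦ by rw [add_mul]; exact add_mem (ha u hu) (hb u hu)
      algebraMap_mem' := fun r u hu ↦ by rw [← Algebra.smul_def]; exact N.smul_mem r hu }
  have hxN : algebraMap R Q (x ^ n) ∈ N := ⟨x ^ n, Ideal.pow_mem_pow hxm n, rfl⟩
  let φ : S →ₗ[R] N :=
    { toFun := fun b ↦ ⟨b * algebraMap R Q (x ^ n), b.2 _ hxN⟩
      map_add' := fun a b ↦ by ext; simp [add_mul]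
      map_smul' := fun r b ↦ by ext; simp }
  have hφ : Function.Injective φ := by
    intro a b hab
    ext
    have h1 : (a : Q) * algebraMap R Q (x ^ n) = b * algebraMap R Q (x ^ n) :=
      congrArg Subtype.val hab
    exact (by rw [map_pow]; exact hxu.pow n : IsUnit (algebraMap R Q (x ^ n))).mul_right_cancel h1
  have hN : IsNoetherian R N :=
    isNoetherian_of_fg_of_noetherian N ((IsNoetherian.noetherian (maximalIdeal R ^ n)).map _)
  exact isIntegral_of_submodule_noetherian S (isNoetherian_of_injective φ hφ) β hβN

theorem notMem_sq_of_pow_succ_le (hx : x ∈ nonZeroDivisors R)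
    (hxm : x ∈ maximalIdeal R)
    (h : maximalIdeal R ^ (n + 1) ≤ Ideal.span {x} * maximalIdeal R ^ n) :
    x ∉ maximalIdeal R * maximalIdeal R := by
  intro hx2
  have h1 : maximalIdeal R ^ (n + 1) ≤ maximalIdeal R • maximalIdeal R ^ (n + 1) := by
    refine h.trans ?_
    rw [smul_eq_mul, pow_succ', ← mul_assoc]
    exact Ideal.mul_mono_left ((Ideal.span_singleton_le_iff_mem _).2 hx2)
  have h2 := Submodule.eq_bot_of_le_smul_of_le_jacobson_bot _ _ (IsNoetherian.noetherian _) h1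
    (maximalIdeal_le_jacobson _)
  have h3 : x ^ (n + 1) = 0 := by
    have := Ideal.pow_mem_pow hxm (n + 1)
    rwa [h2] at this
  exact zero_notMem_nonZeroDivisors (h3 ▸ pow_mem hx (n + 1))

end MinimalReduction

/-! ### Generators modulo an element -/

section Generators

open IsLocalRing

variable {R : Type*} [CommRing R] {N : Type*} [AddCommGroup N] [Module R N] [Module.Finite R N]

/-- Generators of the quotient by `x` lift to generators together with `x`. -/
theorem spanFinrank_top_le_quotient_add_one (x : N) :
    (⊤ : Submodule R N).spanFinrank ≤
      (⊤ : Submodule R (N ⧸ Submodule.span R {x})).spanFinrank + 1 := by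
  classical
  obtain ⟨s, hs, hspan⟩ := Submodule.FG.exists_span_finset_card_eq_spanFinrank
    (Module.Finite.fg_top (R := R) (M := N ⧸ Submodule.span R {x}))
  let t : Finset N := insert x (s.image (Function.surjInv (Submodule.mkQ_surjective _)))
  have ht : Submodule.span R (t : Set N) = ⊤ := by
    have hx : Submodule.span R {x} ≤ Submodule.span R (t : Set N) :=
      Submodule.span_mono (by simp [t])
    have hmap : (Submodule.span R (t : Set N)).map (Submodule.span R {x}).mkQ = ⊤ := by
      rw [Submodule.map_span, ← top_le_iff, ← hspan]
      refine Submodule.span_mono fun a ha ↦ ⟨Function.surjInv (Submodule.mkQ_surjective _) a, ?_,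
        Function.surjInv_eq _ a⟩
      simp only [t, Finset.coe_insert, Finset.coe_image]
      exact Or.inr ⟨a, ha, rfl⟩
    have := congrArg (Submodule.comap (Submodule.span R {x}).mkQ) hmap
    rwa [Submodule.comap_map_eq, Submodule.ker_mkQ, Submodule.comap_top, sup_eq_left.2 hx] at this
  rw [← ht, ← hs]
  refine (Submodule.spanFinrank_span_le_ncard_of_finite t.finite_toSet).trans ?_
  rw [Set.ncard_coe_finset]
  exact (Finset.card_insert_le _ _).trans (Nat.succ_le_succ Finset.card_image_le)

theorem spanFinrank_quotient_add_one_le [IsLocalRing R] {x : N}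
    (hx : x ∉ maximalIdeal R • (⊤ : Submodule R N)) :
    (⊤ : Submodule R (N ⧸ Submodule.span R {x})).spanFinrank + 1 ≤
      (⊤ : Submodule R N).spanFinrank := by
  classical
  obtain ⟨s, hs, hspan⟩ := Submodule.FG.exists_span_finset_card_eq_spanFinrank
    (Module.Finite.fg_top (R := R) (M := N))
  obtain ⟨c, hc⟩ : ∃ c : N → R, ∑ a ∈ s, c a • a = x := by
    have hxs : x ∈ Submodule.span R (s : Set N) := hspan ▸ Submodule.mem_top
    obtain ⟨c, -, hc⟩ := Submodule.mem_span_finset.1 hxs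
    exact ⟨c, hc⟩
  -- some coefficient of `x` is a unit, so `x` can replace the corresponding generator
  obtain ⟨a, ha, hunit⟩ : ∃ a ∈ s, IsUnit (c a) := by
    by_contra! hcon
    refine hx (hc ▸ sum_mem fun a ha ↦ ?_)
    exact Submodule.smul_mem_smul ((mem_maximalIdeal _).2 (hcon a ha)) trivial
  let q := (Submodule.span R {x}).mkQ
  have hq : Submodule.span R ((s.erase a).image q : Set (N ⧸ Submodule.span R {x})) = ⊤ := by
    rw [Finset.coe_image, ← Submodule.map_span, ← LinearMap.range_eq_top.2
      (Submodule.mkQ_surjective (Submodule.span R {x})), ← Submodule.map_top, ← hspan]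
    refine le_antisymm (Submodule.map_mono (Submodule.span_mono (by simp))) ?_
    rw [Submodule.map_span_le]
    intro b hb
    by_cases hba : b = a
    · subst hba
      rw [← Finset.add_sum_erase _ _ ha] at hc
      have h1 : q (c b • b + ∑ a ∈ s.erase b, c a • a) = 0 := by
        rw [hc]
        simp [q]
      have h2 : c b • q b = - q (∑ a ∈ s.erase b, c a • a) := by
        rw [map_add, map_smul] at h1
        exact eq_neg_of_add_eq_zero_left h1
      rw [← Submodule.smul_mem_iff_of_isUnit _ hunit]
      change c b • q b ∈ _
      rw [h2, ← map_neg]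
      exact ⟨_, neg_mem (sum_mem fun a ha ↦ Submodule.smul_mem _ _ (Submodule.subset_span ha)), rfl⟩
    · exact ⟨b, Submodule.subset_span (by simpa [hba] using hb), rfl⟩
  rw [← hq, ← hs, ← Finset.card_erase_add_one ha]
  refine Nat.succ_le_succ ((Submodule.spanFinrank_span_le_ncard_of_finite
    (Finset.finite_toSet _)).trans ?_)
  rw [Set.ncard_coe_finset]
  exact Finset.card_image_le

end Generators

/-! ### Local rings whose maximal ideal is generated by a non-zero-divisor -/

section Dvr

open IsLocalRing

variable {R : Type*} [CommRing R] [IsLocalRing R] [IsNoetherianRing R]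

theorem exists_isDiscreteValuationRing_of_maximalIdeal_eq_span {x : R}
    (hx : x ∈ nonZeroDivisors R) (h : maximalIdeal R = Ideal.span {x}) :
    ∃ _ : IsDomain R, IsDiscreteValuationRing R := by
  have hfac (a : R) (ha : a ≠ 0) : ∃ i, ∃ u : R, IsUnit u ∧ a = u * x ^ i := by
    classical
    have hex : ∃ i, a ∉ maximalIdeal R ^ i := by
      by_contra! hcon
      refine ha ?_
      have := (Ideal.mem_iInf (I := fun i : ℕ ↦ maximalIdeal R ^ i)).2 hcon
      rwa [Ideal.iInf_pow_eq_bot_of_isLocalRing _ (Ideal.IsPrime.ne_top'), Ideal.mem_bot] at this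
    obtain ⟨i, hi⟩ : ∃ i, Nat.find hex = i + 1 := by
      refine Nat.exists_eq_succ_of_ne_zero fun h0 ↦ ?_
      have := Nat.find_spec hex
      simp [h0] at this
    have hmem : a ∈ maximalIdeal R ^ i := not_not.1 (Nat.find_min hex (m := i) (by omega))
    have hnot : a ∉ maximalIdeal R ^ (i + 1) := hi ▸ Nat.find_spec hex
    rw [h, Ideal.span_singleton_pow, Ideal.mem_span_singleton'] at hmem hnot
    obtain ⟨u, rfl⟩ := hmem
    refine ⟨i, u, ?_, rfl⟩
    by_contra hu
    rw [← mem_nonunits_iff, ← mem_maximalIdeal, h, Ideal.mem_span_singleton'] at hu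
    obtain ⟨v, rfl⟩ := hu
    exact hnot ⟨v, by ring⟩
  have hdom : IsDomain R := by
    have : NoZeroDivisors R := ⟨fun {a b} hab ↦ by
      by_contra! hcon
      obtain ⟨i, u, hu, rfl⟩ := hfac a hcon.1
      obtain ⟨j, v, hv, rfl⟩ := hfac b hcon.2
      have : u * x ^ i * (v * x ^ j) ∈ nonZeroDivisors R :=
        mul_mem (mul_mem hu.mem_nonZeroDivisors (pow_mem hx i))
          (mul_mem hv.mem_nonZeroDivisors (pow_mem hx j))
      exact zero_notMem_nonZeroDivisors (hab ▸ this)⟩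
    exact NoZeroDivisors.to_isDomain R
  have hfield : ¬IsField R := by
    rw [isField_iff_maximalIdeal_eq, h, Ideal.span_singleton_eq_bot]
    exact nonZeroDivisors.ne_zero hx
  have htfae : IsDiscreteValuationRing R ↔ (maximalIdeal R).IsPrincipal :=
    (IsDiscreteValuationRing.TFAE R hfield).out 0 4
  exact ⟨hdom, htfae.2 ⟨⟨x, h⟩⟩⟩

end Dvr

/-! ### The colength of a minimal reduction against the conductor -/

section Main

open IsLocalRing

variable {R : Type*} [CommRing R] [IsLocalRing R]

theorem length_quotient_eq_one_iff {I : Ideal R} :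
    Module.length R (R ⧸ I) = 1 ↔ maximalIdeal R = I := by
  rw [Module.length_eq_one_iff, isSimpleModule_iff_isCoatom, ← Ideal.isMaximal_def]
  exact ⟨fun h ↦ (eq_maximalIdeal h).symm, fun h ↦ h ▸ inferInstance⟩

theorem length_quotient_sup_span_lt {R : Type*} [CommRing R] {I : Ideal R} {x : R}
    (hI : Module.length R (R ⧸ I) ≠ ⊤)
    (hx : x ∉ I) : Module.length R (R ⧸ I ⊔ Ideal.span {x}) < Module.length R (R ⧸ I) := by
  let g : (R ⧸ I) →ₗ[R] R ⧸ I ⊔ Ideal.span {x} := Submodule.factor le_sup_left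
  have hg : Function.Surjective g := Submodule.factor_surjective _
  refine lt_of_le_of_ne (Module.length_le_of_surjective g hg) fun heq ↦ hx ?_
  have h1 := Module.length_eq_add_of_exact (LinearMap.ker g).subtype g
    (Submodule.subtype_injective _) hg (LinearMap.exact_subtype_ker_map g)
  rw [heq] at h1
  have h2 : Module.length R (LinearMap.ker g) = 0 :=
    WithTop.add_right_cancel hI (h1.symm.trans (zero_add _).symm)
  have h3 := Module.length_eq_zero_iff.1 h2
  have hxk : Submodule.Quotient.mk x ∈ LinearMap.ker g := by
    change Submodule.Quotient.mk x = 0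
    rw [Submodule.Quotient.mk_eq_zero]
    exact Ideal.mem_sup_right (Ideal.mem_span_singleton_self x)
  have h4 : (⟨Submodule.Quotient.mk x, hxk⟩ : LinearMap.ker g) = 0 := Subsingleton.elim _ _
  exact (Submodule.Quotient.mk_eq_zero I).1 (congrArg Subtype.val h4)

theorem length_quotient_span_eq {x : R} (hxm : x ∈ maximalIdeal R) :
    Module.length R (R ⧸ Ideal.span {x}) = Module.length R
      (maximalIdeal R ⧸ Submodule.span R {(⟨x, hxm⟩ : maximalIdeal R)}) + 1 := by
  have h := length_quotient_map (maximalIdeal R).subtype (Submodule.subtype_injective _)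
    (Submodule.span R {(⟨x, hxm⟩ : maximalIdeal R)})
  rw [Submodule.range_subtype, length_quotient_eq_one_iff.2 rfl, Submodule.map_span,
    Set.image_singleton] at h
  exact h

variable [IsNoetherianRing R]

/-- If `I` multiplies `𝔪` into `x R`, then `𝔪 / x R` is a module over `R ⧸ I`. -/
theorem length_quotient_span_le {x : R} (hxm : x ∈ maximalIdeal R) {I : Ideal R}
    (hI : ∀ r ∈ I, ∀ y ∈ maximalIdeal R, r * y ∈ Ideal.span {x}) :
    Module.length R (maximalIdeal R ⧸ Submodule.span R {(⟨x, hxm⟩ : maximalIdeal R)}) ≤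
      (⊤ : Submodule R
        (maximalIdeal R ⧸ Submodule.span R {(⟨x, hxm⟩ : maximalIdeal R)})).spanFinrank *
      Module.length R (R ⧸ I) := by
  refine length_le_spanFinrank_mul I fun r hr m ↦ ?_
  obtain ⟨y, rfl⟩ := Submodule.Quotient.mk_surjective _ m
  rw [← Submodule.Quotient.mk_smul, Submodule.Quotient.mk_eq_zero, Submodule.mem_span_singleton]
  obtain ⟨a, ha⟩ := Ideal.mem_span_singleton'.1 (hI r hr y y.2)
  exact ⟨a, Subtype.ext ha⟩

/-- An element of `𝔪` outside `𝔪 ^ 2` belongs to a minimal set of generators. -/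
theorem embeddingDim_eq {x : R} (hxm : x ∈ maximalIdeal R)
    (hx2 : x ∉ maximalIdeal R * maximalIdeal R) :
    LocalRingInvariants.embeddingDim R = (⊤ : Submodule R
      (maximalIdeal R ⧸ Submodule.span R {(⟨x, hxm⟩ : maximalIdeal R)})).spanFinrank + 1 := by
  rw [LocalRingInvariants.embeddingDim, ← Submodule.spanFinrank_top]
  refine le_antisymm (spanFinrank_top_le_quotient_add_one _)
    (spanFinrank_quotient_add_one_le fun hx ↦ hx2 ?_)
  have h1 := Submodule.mem_map_of_mem (f := (maximalIdeal R).subtype) hx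
  rw [Submodule.map_smul'', Submodule.map_top, Submodule.range_subtype] at h1
  exact h1

/-- If `y = x β` with `β` integral, then `r y = x (r β)`, where `r β` lies in `R`. -/
theorem mul_mem_span_of_mem_conductorIdeal {x : R} (hx : x ∈ nonZeroDivisors R)
    (hxm : x ∈ maximalIdeal R) {n : ℕ}
    (h : maximalIdeal R ^ (n + 1) ≤ Ideal.span {x} * maximalIdeal R ^ n) {r y : R}
    (hr : r ∈ LocalRingInvariants.conductorIdeal R) (hy : y ∈ maximalIdeal R) :
    r * y ∈ Ideal.span {x} := by
  obtain ⟨β, hβ, hxy⟩ := exists_isIntegral_mul_eq (Q := FractionRing R) hx hxm h hy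
  obtain ⟨t, ht⟩ := mem_conductorIdeal.1 hr β hβ
  refine Ideal.mem_span_singleton'.2 ⟨t, ?_⟩
  apply IsLocalization.injective (FractionRing R) (le_refl (nonZeroDivisors R))
  rw [map_mul, map_mul, ht, ← hxy]
  ring

/-- If a minimal reduction `x` is in the conductor, so is `𝔪`, since `𝔪 ⊆ x R̄`. -/
theorem maximalIdeal_le_conductorIdeal {x : R} (hx : x ∈ nonZeroDivisors R)
    (hxm : x ∈ maximalIdeal R) {n : ℕ}
    (h : maximalIdeal R ^ (n + 1) ≤ Ideal.span {x} * maximalIdeal R ^ n)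
    (hxc : x ∈ LocalRingInvariants.conductorIdeal R) :
    maximalIdeal R ≤ LocalRingInvariants.conductorIdeal R := by
  intro y hy
  obtain ⟨β, hβ, hxy⟩ := exists_isIntegral_mul_eq (Q := FractionRing R) hx hxm h hy
  refine mem_conductorIdeal.2 fun γ hγ ↦ ?_
  obtain ⟨t, ht⟩ := mem_conductorIdeal.1 hxc (β * γ) (hβ.mul hγ)
  exact ⟨t, by rw [ht, ← hxy, mul_assoc]⟩

end Main

end OneDimLocal

open IsLocalRing LocalRingInvariants OneDimLocal in
/-- The first two conjuncts say that the limit defining `e(R)` exists and that the length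
`ℓ(R/𝔠)` is finite, so that the real numbers in the other conjuncts are the intended ones. -/
theorem theorem1p2 {R : Type*} [CommRing R] [IsLocalRing R]
    (hdim : ringKrullDim R = 1)
    (hCM : LocalRingInvariants.IsCohenMacaulay R)
    (hAU : LocalRingInvariants.IsAnalyticallyUnramified R)
    (hinf : Infinite (IsLocalRing.ResidueField R)) :
    Tendsto (LocalRingInvariants.normalizedHilbertSamuel R) atTop
        (𝓝 (LocalRingInvariants.hilbertSamuelMultiplicity R)) ∧
    Module.length R (R ⧸ LocalRingInvariants.conductorIdeal R) ≠ ⊤ ∧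
    LocalRingInvariants.hilbertSamuelMultiplicity R ≤
        ((LocalRingInvariants.embeddingDim R : ℝ) - 1) *
          ((Module.length R (R ⧸ LocalRingInvariants.conductorIdeal R)).toNat : ℝ) + 1 ∧
    (LocalRingInvariants.hilbertSamuelMultiplicity R =
        ((LocalRingInvariants.embeddingDim R : ℝ) - 1) *
          ((Module.length R (R ⧸ LocalRingInvariants.conductorIdeal R)).toNat : ℝ) + 1 ↔
      (∃ _ : IsDomain R, IsDiscreteValuationRing R) ∨
        Module.length R (R ⧸ LocalRingInvariants.conductorIdeal R) = 1) ∧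
    (Module.length R (R ⧸ LocalRingInvariants.conductorIdeal R) = 1 ↔
      IsLocalRing.maximalIdeal R = LocalRingInvariants.conductorIdeal R) := by
  have : IsNoetherianRing R := hCM.isNoetherianRing
  obtain ⟨z, hzm, hz⟩ := exists_mem_nonZeroDivisors hdim hCM
  obtain ⟨x, hxm, hx, n, hred⟩ := exists_minimalReduction hdim hz hzm
  have htend := tendsto_normalizedHilbertSamuel hdim hx hxm hred
  have he : hilbertSamuelMultiplicity R = _ := htend.limUnder_eq
  have hctop := length_quotient_conductorIdeal_ne_top hdim hAU hx hxm
  have hxtop := length_quotient_span_ne_top hdim hx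
  have hxlen := length_quotient_span_eq hxm
  -- from here on `ℓ(M) = e(R) - 1` and `M` has `ν - 1` generators
  set M := maximalIdeal R ⧸ Submodule.span R {(⟨x, hxm⟩ : maximalIdeal R)} with hM
  have hMtop : Module.length R M ≠ ⊤ := fun h ↦ hxtop (by rw [hxlen, h]; rfl)
  have hν : embeddingDim R = (⊤ : Submodule R M).spanFinrank + 1 :=
    embeddingDim_eq hxm (notMem_sq_of_pow_succ_le hx hxm hred)
  have hle : Module.length R M ≤ (⊤ : Submodule R M).spanFinrank *
      Module.length R (R ⧸ conductorIdeal R) :=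
    length_quotient_span_le hxm fun r hr y hy ↦
      mul_mem_span_of_mem_conductorIdeal hx hxm hred hr hy
  -- a module has length at least its number of generators
  have hge : ((⊤ : Submodule R M).spanFinrank : ℕ∞) ≤ Module.length R M := by
    refine (spanFinrank_le_length_quotient ⊥ bot_le).trans ?_
    exact Module.length_le_of_surjective _ (Submodule.quotEquivOfEqBot _ rfl).symm.surjective
  -- `x` kills `M` as well, so the bound is strict unless `x` is already in the conductor
  have hxc : x ∉ conductorIdeal R → 0 < (⊤ : Submodule R M).spanFinrank →
      Module.length R M < (⊤ : Submodule R M).spanFinrank *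
        Module.length R (R ⧸ conductorIdeal R) := by
    intro hx' hpos
    have h1 := length_quotient_span_le hxm (I := conductorIdeal R ⊔ Ideal.span {x}) (by
      intro r hr y hy
      obtain ⟨a, ha, b, hb, rfl⟩ := Submodule.mem_sup.1 hr
      rw [add_mul]
      exact add_mem (mul_mem_span_of_mem_conductorIdeal hx hxm hred ha hy)
        (Ideal.mul_mem_right _ _ hb))
    have h2 := length_quotient_sup_span_lt hctop hx'
    refine h1.trans_lt ?_
    lift Module.length R (R ⧸ conductorIdeal R ⊔ Ideal.span {x}) to ℕ using h2.ne_top with a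
    lift Module.length R (R ⧸ conductorIdeal R) to ℕ using hctop with b
    norm_cast at h2 ⊢
    exact Nat.mul_lt_mul_of_pos_left h2 hpos
  have hone : Module.length R (R ⧸ conductorIdeal R) = 1 ↔ maximalIdeal R = conductorIdeal R :=
    length_quotient_eq_one_iff
  have hzero : conductorIdeal R = ⊤ → Module.length R (R ⧸ conductorIdeal R) = 0 := fun h ↦ by
    rw [Module.length_eq_zero_iff, h]
    exact Ideal.Quotient.subsingleton_iff.2 rfl
  have hspan : Module.length R (R ⧸ Ideal.span {x}) = 1 ↔ maximalIdeal R = Ideal.span {x} :=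
    length_quotient_eq_one_iff
  have hprin : (∃ _ : IsDomain R, IsDiscreteValuationRing R) → embeddingDim R ≤ 1 := by
    rintro ⟨_, _⟩
    obtain ⟨a, ha⟩ := (IsPrincipalIdealRing.principal (maximalIdeal R)).principal
    rw [embeddingDim, ha]
    exact (Submodule.spanFinrank_span_le_ncard_of_finite (Set.finite_singleton a)).trans
      (Set.ncard_singleton a).le
  refine ⟨he ▸ htend, hctop, ?_⟩
  rw [he, hν, hxlen, ENat.toNat_add hMtop ENat.one_ne_top, ← hone]
  rw [hxlen] at hspan
  generalize (⊤ : Submodule R M).spanFinrank = g at *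
  generalize Module.length R M = a at *
  generalize Module.length R (R ⧸ conductorIdeal R) = c at *
  lift a to ℕ using hMtop
  lift c to ℕ using hctop
  simp only [ENat.toNat_natCast, ENat.toNat_one]
  norm_cast at hle hge hxc hone hzero hspan
  push_cast
  rw [add_sub_cancel_right, add_le_add_iff_right, add_left_inj]
  norm_cast
  refine ⟨hle, ⟨fun heq ↦ ?_, ?_⟩, trivial⟩
  · rcases Nat.eq_zero_or_pos g with hg | hg
    · refine .inl (exists_isDiscreteValuationRing_of_maximalIdeal_eq_span hx (hspan.1 ?_))
      rw [heq, hg, zero_mul]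
    · refine .inr (hone.2 ?_)
      have hxc' : x ∈ conductorIdeal R := by
        by_contra hx'
        exact (hxc hx' hg).ne heq
      refine (maximalIdeal.isMaximal R).eq_of_le (fun h ↦ ?_)
        (maximalIdeal_le_conductorIdeal hx hxm hred hxc')
      have := hzero h
      subst this
      omega
  · rintro (hdvr | hc)
    · obtain rfl : g = 0 := by have := hprin hdvr; omega
      simpa using hle
    · subst hc
      omega
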